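/- Consider oriented singular link diagrams, and more generally oriented singular tangle diagrams, in the plane: generic diagrams of oriented strands whose double points are classical crossings or singular crossings (rigid 4-valent vertices through which both oriented strands pass), regarded up to planar isotopy. (In the formal statement diagrams are given in sliced form, that is, as stacks of minima, maxima and crossings, and planar isotopy is generated by the elementary changes of slicing: exchange of heights, cancellation of a maximum and a minimum, and sliding of a crossing past a maximum or a minimum of one of its strands.) The complete set of oriented singular moves consists of the following local moves. * $\Omega4$: a third strand that lies over both strands of a singular crossing, or under both of them, is moved across the singular crossing from one side to the other; all orientations of the three strands are allowed. * $\Omega5$: a classical crossing, of either type, between the two strands of a singular crossing is moved from one side of the singular crossing to the opposite side; all orientations of the two strands are allowed. Single out the following three of these moves. In each of them, all strands point upwards. * sII: a positive crossing of the two strands directly after (above) a singular crossing is moved to directly before (below) it. * sIII: a strand running from bottom right to top left over the two strands of a singular crossing is moved across the singular crossing from above it to below it. * sIII$'$: the same as sIII, with the third strand running under the other two strands. Then, in the presence of all oriented classical Reidemeister moves (of types I, II and III), the moves sII, sIII and sIII$'$ generate the complete set of oriented singular moves. That is, two oriented singular diagrams with the same endpoints are related by a finite sequence of planar isotopies, oriented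 classical Reidemeister moves, moves sII, sIII, sIII$'$ and their inverses if and only if they are related by a finite sequence of planar isotopies, oriented classical Reidemeister moves, moves of the types $\Omega4$ and $\Omega5$ with arbitrary orientations, and their inverses. In particular this holds for link diagrams. -/

import Mathlib

/-!
Oriented singular tangle and link diagrams in the plane, in sliced (Morse) form.

A diagram is put in general position with respect to the height function and is cut by
horizontal lines into layers, each of which contains exactly one of the following events
besides vertical strands: a local minimum, a local maximum, a classical crossing, or a
singular crossing. Diagrams are read from bottom to top. A link diagram is a diagram
without endpoints.
-/

namespace SingularLink

/-- The direction of an oriented strand at a point of a horizontal slicing line. -/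
inductive Dir where
  | up : Dir
  | down : Dir

/-- The opposite direction. -/
def Dir.flip : Dir → Dir
  | .up => .down
  | .down => .up

/-- The types of crossing of two monotone strands, one of which runs between bottom left and
top right (the NE strand) and the other one between bottom right and top left (the NW strand):
* `ne`: classical crossing, the NE strand is the over-strand;
* `nw`: classical crossing, the NW strand is the over-strand;
* `singular`: singular crossing (rigid 4-valent vertex).
If both strands point up, `ne` is the positive and `nw` the negative crossing. -/
inductive Kind where
  | ne : Kind
  | nw : Kind
  | singular : Kind

/-- The type of the same crossing when the roles of the NE strand and of the NW strand
are exchanged. -/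
def Kind.swap : Kind → Kind
  | .ne => .nw
  | .nw => .ne
  | .singular => .singular

/-- A crossing type is classical if it is not singular. -/
def Kind.IsClassical (k : Kind) : Prop := k ≠ .singular

/-- The elementary events of a sliced oriented diagram:
* `cup d`: a local minimum, whose left leg has direction `d` and whose right leg has the
  opposite direction;
* `cap d`: a local maximum, whose left leg has direction `d` and whose right leg has the
  opposite direction;
* `cross k p q`: a crossing of type `k`; the NE strand has direction `p`, the NW strand has
  direction `q`. -/
inductive Event where
  | cup (d : Dir) : Event
  | cap (d : Dir) : Event
  | cross (k : Kind) (p q : Dir) : Event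

/-- Directions of the lower endpoints of an event, from left to right. -/
def Event.bot : Event → List Dir
  | .cup _ => []
  | .cap d => [d, d.flip]
  | .cross _ p q => [p, q]

/-- Directions of the upper endpoints of an event, from left to right. -/
def Event.top : Event → List Dir
  | .cup d => [d, d.flip]
  | .cap _ => []
  | .cross _ p q => [q, p]

/-- A layer of a sliced diagram: one event, with vertical strands of the given directions on
its left and on its right. -/
structure Layer where
  left : List Dir
  event : Event
  right : List Dir

/-- Directions of the strands at the lower boundary line of a layer. -/
def Layer.bot (s : Layer) : List Dir := s.left ++ s.event.bot ++ s.right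

/-- Directions of the strands at the upper boundary line of a layer. -/
def Layer.top (s : Layer) : List Dir := s.left ++ s.event.top ++ s.right

/-- Add vertical strands `l` on the left and `r` on the right of a layer. -/
def Layer.widen (l r : List Dir) (s : Layer) : Layer := ⟨l ++ s.left, s.event, s.right ++ r⟩

/-- `IsSliced a w b`: the layers `w`, stacked from bottom to top, fit together (with matching
orientations) to a diagram with lower endpoints `a` and upper endpoints `b`. -/
def IsSliced : List Dir → List Layer → List Dir → Prop
  | a, [], b => a = b
  | a, s :: w, b => s.bot = a ∧ IsSliced s.top w b

/-- An oriented singular tangle diagram with lower endpoints `a` and upper endpoints `b`. -/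
structure Diagram (a b : List Dir) where
  layers : List Layer
  sliced : IsSliced a layers b

/-- An oriented singular link diagram: a diagram without endpoints. -/
abbrev LinkDiagram : Type := Diagram [] []

/-! ### Local pictures -/

/-- Three strands with directions `p`, `q`, `r` (from left to right at the bottom) that cross
pairwise; first the strands `p` and `q` cross. The crossings of `p` with `q`, of `p` with `r` and
of `q` with `r` have the types `i`, `j`, `k`. -/
def triangleLow (i j k : Kind) (p q r : Dir) : List Layer :=
  [⟨[], .cross i p q, [r]⟩, ⟨[q], .cross j p r, []⟩, ⟨[], .cross k q r, [p]⟩]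

/-- The same three strands on the other side of the triangle; now the strands `q` and `r`
cross first. -/
def triangleHigh (i j k : Kind) (p q r : Dir) : List Layer :=
  [⟨[p], .cross k q r, []⟩, ⟨[], .cross j p r, [q]⟩, ⟨[r], .cross i p q, []⟩]

/-- Elementary planar isotopies: the local changes that the slicing of a diagram undergoes in a
generic isotopy of the plane. -/
inductive PlanarIsotopy : List Layer → List Layer → Prop where
  /-- Two events side by side exchange their heights. -/
  | exchange (e f : Event) (m : List Dir) :
      PlanarIsotopy
        [⟨[], e, m ++ f.bot⟩, ⟨e.top ++ m, f, []⟩]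
        [⟨e.bot ++ m, f, []⟩, ⟨[], e, m ++ f.top⟩]
  /-- A local maximum and the local minimum on its right cancel. -/
  | zigzagRight (d : Dir) :
      PlanarIsotopy [⟨[d], .cup d.flip, []⟩, ⟨[], .cap d, [d]⟩] []
  /-- A local maximum and the local minimum on its left cancel. -/
  | zigzagLeft (d : Dir) :
      PlanarIsotopy [⟨[], .cup d, [d]⟩, ⟨[d], .cap d.flip, []⟩] []
  /-- A crossing moves through a local maximum of one of its strands, from the left leg of the
  maximum to the right leg. -/
  | capSlide (k : Kind) (p q : Dir) :
      PlanarIsotopy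
        [⟨[], .cross k p q, [p.flip]⟩, ⟨[q], .cap p, []⟩]
        [⟨[p], .cross k.swap q p.flip, []⟩, ⟨[], .cap p, [q]⟩]
  /-- A crossing moves through a local minimum of one of its strands, from the left leg of the
  minimum to the right leg. -/
  | cupSlide (k : Kind) (p q : Dir) :
      PlanarIsotopy
        [⟨[q], .cup p, []⟩, ⟨[], .cross k q p, [p.flip]⟩]
        [⟨[], .cup p, [q]⟩, ⟨[p], .cross k.swap p.flip q, []⟩]

/-- The classical Reidemeister moves, with all orientations of the strands and all crossing
types that they admit. -/
inductive ClassicalMove : List Layer → List Layer → Prop where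
  /-- First move, the loop on the right of the strand. -/
  | oneRight (k : Kind) (hk : k.IsClassical) (d : Dir) :
      ClassicalMove
        [⟨[d], .cup d, []⟩, ⟨[], .cross k d d, [d.flip]⟩, ⟨[d], .cap d, []⟩] []
  /-- First move, the loop on the left of the strand. -/
  | oneLeft (k : Kind) (hk : k.IsClassical) (d : Dir) :
      ClassicalMove
        [⟨[], .cup d.flip, [d]⟩, ⟨[d.flip], .cross k d d, []⟩, ⟨[], .cap d.flip, [d]⟩] []
  /-- Second move: the same strand is the over-strand at both crossings. -/
  | two (k : Kind) (hk : k.IsClassical) (p q : Dir) :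
      ClassicalMove [⟨[], .cross k p q, []⟩, ⟨[], .cross k.swap q p, []⟩] []
  /-- Third move: the hypothesis `i = j ∨ j = k` says that the three strands lie at three
  different levels, as opposed to lying cyclically over each other. -/
  | three (i j k : Kind) (hi : i.IsClassical) (hj : j.IsClassical) (hk : k.IsClassical)
      (hijk : i = j ∨ j = k) (p q r : Dir) :
      ClassicalMove (triangleLow i j k p q r) (triangleHigh i j k p q r)

/-- The complete set of singular moves, with all orientations of the strands and all crossing
types that they admit. -/
inductive SingularMove : List Layer → List Layer → Prop where
  /-- A third strand `r` passes across the singular crossing of the strands `p` and `q`; it lies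
  over both of them (`k = nw`) or under both of them (`k = ne`). -/
  | four (k : Kind) (hk : k.IsClassical) (p q r : Dir) :
      SingularMove (triangleLow .singular k k p q r) (triangleHigh .singular k k p q r)
  /-- A classical crossing of the two strands of a singular crossing passes from one side of the
  singular crossing to the opposite side. -/
  | five (k : Kind) (hk : k.IsClassical) (p q : Dir) :
      SingularMove
        [⟨[], .cross .singular p q, []⟩, ⟨[], .cross k q p, []⟩]
        [⟨[], .cross k p q, []⟩, ⟨[], .cross .singular q p, []⟩]

/-- The three moves sII, sIII, sIII′; all strands point up. -/
inductive ThreeMove : List Layer → List Layer → Prop where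
  /-- A positive crossing passes from one side of a singular crossing to the other. -/
  | sII :
      ThreeMove
        [⟨[], .cross .singular .up .up, []⟩, ⟨[], .cross .ne .up .up, []⟩]
        [⟨[], .cross .ne .up .up, []⟩, ⟨[], .cross .singular .up .up, []⟩]
  /-- A strand that runs from bottom right to top left passes over a singular crossing. -/
  | sIII :
      ThreeMove (triangleLow .singular .nw .nw .up .up .up)
        (triangleHigh .singular .nw .nw .up .up .up)
  /-- A strand that runs from bottom right to top left passes under a singular crossing. -/
  | sIII' :
      ThreeMove (triangleLow .singular .ne .ne .up .up .up)
        (triangleHigh .singular .ne .ne .up .up .up)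

/-- `D'` arises from `D` by one replacement, in a rectangular part of the diagram, of the left
hand side of a local move in `M` by its right hand side. -/
def Step (M : List Layer → List Layer → Prop) {a b : List Dir} (D D' : Diagram a b) : Prop :=
  ∃ (L R before after : List Layer) (l r : List Dir), M L R ∧
    D.layers = before ++ L.map (Layer.widen l r) ++ after ∧
    D'.layers = before ++ R.map (Layer.widen l r) ++ after

/-- Two diagrams are equivalent with respect to a set `S` of singular moves if they are related
by a finite sequence of planar isotopies, classical Reidemeister moves, moves in `S`, and
their inverses. -/
def Equivalent (S : List Layer → List Layer → Prop) {a b : List Dir} :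
    Diagram a b → Diagram a b → Prop :=
  Relation.EqvGen (Step fun L R => PlanarIsotopy L R ∨ ClassicalMove L R ∨ S L R)

end SingularLink

namespace SingularLink

/-! One direction holds because sII, sIII and sIII′ are instances of Ω5 and Ω4. For the converse,
every Ω4 and Ω5 is derived from the three moves, and the local derivation is carried out inside the
surrounding diagram (`WordEquiv.inContext`).

Stacking makes tangles a category in which each of these moves says that a singular crossing
commutes with some classical crossings. Two mechanisms produce new moves from old ones. Reidemeister
II makes classical crossings invertible, and commuting with a morphism implies commuting with its
inverse (`WordEquiv.conj`). Planar isotopy allows an endpoint to be bent down and straightened again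
without loss (`WordEquiv.of_cap`), so local pictures can be rotated.

For Ω4, sIII and sIII′ provide both levels of the third strand with all strands up. Inversion
exchanges the two diagonals along which this strand runs, bending reverses it (`NEPass.flip`), and
quarter turns of the singular crossing (`NEPass.rotate`) reach all directions of the other two
strands.

For Ω5, inverting sII provides the negative crossing. A quarter turn (`CrossingPass.rotate`) then
costs two Ω4 moves, already available, and the removal of kinks by Reidemeister I. -/

@[simp] theorem Dir.flip_flip (d : Dir) : d.flip.flip = d := by cases d <;> rfl

@[simp] theorem Kind.swap_swap (k : Kind) : k.swap.swap = k := by cases k <;> rfl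

theorem Kind.IsClassical.swap {k : Kind} (hk : k.IsClassical) : k.swap.IsClassical := by
  cases k <;> simp_all [Kind.IsClassical, Kind.swap]

/-! ### Sliced words -/

@[simp] theorem Layer.widen_nil : Layer.widen [] [] = id := by
  funext s
  simp [Layer.widen]

theorem Layer.widen_widen (l r l' r' : List Dir) (s : Layer) :
    (s.widen l' r').widen l r = s.widen (l ++ l') (r' ++ r) := by simp [Layer.widen]

theorem map_widen_widen (l r l' r' : List Dir) (w : List Layer) :
    (w.map (Layer.widen l' r')).map (Layer.widen l r) =
      w.map (Layer.widen (l ++ l') (r' ++ r)) := by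
  simp [Function.comp_def, Layer.widen_widen]

theorem isSliced_append {a c : List Dir} {u v : List Layer} :
    IsSliced a (u ++ v) c ↔ ∃ b, IsSliced a u b ∧ IsSliced b v c := by
  induction u generalizing a with
  | nil => simp [IsSliced]
  | cons s u ih => simp [IsSliced, ih, and_assoc]

theorem IsSliced.append {a b c : List Dir} {u v : List Layer}
    (hu : IsSliced a u b) (hv : IsSliced b v c) : IsSliced a (u ++ v) c :=
  isSliced_append.2 ⟨b, hu, hv⟩

theorem IsSliced.widen {a b : List Dir} {w : List Layer} (h : IsSliced a w b) (l r : List Dir) :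
    IsSliced (l ++ a ++ r) (w.map (Layer.widen l r)) (l ++ b ++ r) := by
  induction w generalizing a with
  | nil => simpa [IsSliced] using h
  | cons s w ih =>
    obtain ⟨rfl, h⟩ := h
    refine ⟨by simp [Layer.bot, Layer.widen], ?_⟩
    simpa [Layer.top, Layer.widen] using ih h

/-- The first layer fixes the lower endpoints, and each layer then fixes the next slicing line. The
empty word has to be excluded: it is a diagram over every list of directions. -/
theorem IsSliced.endpoints_unique {a b a' b' : List Dir} {w : List Layer} (h : IsSliced a w b)
    (h' : IsSliced a' w b') (hw : w ≠ []) : a = a' ∧ b = b' := by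
  have top_unique : ∀ {c : List Dir} {w : List Layer}, IsSliced c w b → IsSliced c w b' → b = b' := by
    intro c w
    induction w generalizing c with
    | nil => exact fun h h' => h.symm.trans h'
    | cons s w ih => exact fun h h' => ih h.2 h'.2
  cases w with
  | nil => exact absurd rfl hw
  | cons s w => exact ⟨h.1.symm.trans h'.1, top_unique h.2 h'.2⟩

/-! ### Equivalence of words -/

/-- Two words of layers are both sliced diagrams from `a` to `b`, and these are equivalent. -/
def WordEquiv (S : List Layer → List Layer → Prop) (a b : List Dir) (w v : List Layer) : Prop :=
  ∃ (hw : IsSliced a w b) (hv : IsSliced a v b), Equivalent S ⟨w, hw⟩ ⟨v, hv⟩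

namespace WordEquiv

variable {S : List Layer → List Layer → Prop} {a b c x y : List Dir} {u v w z : List Layer}

theorem refl (h : IsSliced a w b) : WordEquiv S a b w w := ⟨h, h, .refl _⟩

theorem symm (h : WordEquiv S a b w v) : WordEquiv S a b v w :=
  let ⟨hw, hv, e⟩ := h
  ⟨hv, hw, e.symm _ _⟩

theorem trans (h : WordEquiv S a b u v) (h' : WordEquiv S a b v w) : WordEquiv S a b u w :=
  let ⟨hu, _, e⟩ := h
  let ⟨_, hw, e'⟩ := h'
  ⟨hu, hw, e.trans _ _ _ e'⟩

instance : Trans (WordEquiv S a b) (WordEquiv S a b) (WordEquiv S a b) := ⟨trans⟩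

theorem of_move (h : PlanarIsotopy w v ∨ ClassicalMove w v ∨ S w v)
    (hw : IsSliced a w b) (hv : IsSliced a v b) : WordEquiv S a b w v :=
  ⟨hw, hv, .rel _ _ ⟨w, v, [], [], [], [], h, by simp, by simp⟩⟩

/-- Every diagram in a chain from `w` to `v` has endpoints `a` and `b`, so the whole chain can be
inserted into the same surroundings, and each step remains a step. -/
theorem inContext (h : WordEquiv S a b w v) (l r : List Dir) {s t : List Layer}
    (hs : IsSliced x s (l ++ a ++ r)) (ht : IsSliced (l ++ b ++ r) t y) :
    WordEquiv S x y (s ++ w.map (Layer.widen l r) ++ t) (s ++ v.map (Layer.widen l r) ++ t) := by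
  obtain ⟨hw, hv, e⟩ := h
  let F : Diagram a b → Diagram x y := fun D =>
    ⟨s ++ D.layers.map (Layer.widen l r) ++ t, (hs.append (D.sliced.widen l r)).append ht⟩
  suffices H : ∀ D D' : Diagram a b, Equivalent S D D' → Equivalent S (F D) (F D') from
    ⟨(F ⟨w, hw⟩).sliced, (F ⟨v, hv⟩).sliced, H _ _ e⟩
  intro D D' e
  induction e with
  | rel D D' h =>
    obtain ⟨L, R, before, after, l', r', hM, h1, h2⟩ := h
    refine .rel _ _ ⟨L, R, s ++ before.map (Layer.widen l r), after.map (Layer.widen l r) ++ t,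
      l ++ l', r' ++ r, hM, ?_, ?_⟩
    · simp [F, h1, Layer.widen_widen]
    · simp [F, h2, Layer.widen_widen]
  | refl D => exact .refl _
  | symm _ _ _ ih => exact ih.symm _ _
  | trans _ _ _ _ _ ih ih' => exact ih.trans _ _ _ ih'

theorem comp (h : WordEquiv S a b w v) (h' : WordEquiv S b c u z) :
    WordEquiv S a c (w ++ u) (v ++ z) := by
  have hu := h'.choose
  have hv := h.choose_spec.choose
  have h1 := h.inContext (x := a) (y := c) (s := []) (t := u) [] [] (by simp [IsSliced])
    (by simpa using hu)
  have h2 := h'.inContext (x := a) (y := c) (s := v) (t := []) [] [] (by simpa using hv)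
    (by simp [IsSliced])
  simp only [List.nil_append, List.append_nil, Layer.widen_nil, List.map_id] at h1 h2
  exact h1.trans h2

theorem widen (h : WordEquiv S a b w v) (l r : List Dir) :
    WordEquiv S (l ++ a ++ r) (l ++ b ++ r) (w.map (Layer.widen l r))
      (v.map (Layer.widen l r)) := by
  simpa using h.inContext (s := []) (t := []) l r (by simp [IsSliced]) (by simp [IsSliced])

/-- Replacement inside of the word `W` of the layers from position `n` on. -/
theorem replace (h : WordEquiv S a b w v) (n : ℕ) (l r : List Dir) {W V : List Layer}
    (hW : W = W.take n ++ w.map (Layer.widen l r) ++ W.drop (n + w.length) := by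
      first | rfl | simp [Layer.widen, Event.bot, Event.top, Kind.swap])
    (hV : V = W.take n ++ v.map (Layer.widen l r) ++ W.drop (n + w.length) := by
      first | rfl | simp [Layer.widen, Event.bot, Event.top, Kind.swap])
    (hs : IsSliced x (W.take n) (l ++ a ++ r) := by
      simp [IsSliced, Layer.bot, Layer.top, Event.bot, Event.top, triangleLow, triangleHigh])
    (ht : IsSliced (l ++ b ++ r) (W.drop (n + w.length)) y := by
      simp [IsSliced, Layer.bot, Layer.top, Event.bot, Event.top, triangleLow, triangleHigh]) :
    WordEquiv S x y W V := by
  rw [hV]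
  -- `W` also occurs on the right of `hW` and in the new target word, so only the source word is
  -- rewritten.
  conv => arg 4; rw [hW]
  exact h.inContext l r hs ht

/-- Commutation with a morphism implies commutation with its inverse. -/
theorem conj {a' b' : List Dir} {f g c₁ c₂ d₁ d₂ : List Layer}
    (h : WordEquiv S a b' (f ++ c₂) (c₁ ++ g))
    (hd : IsSliced a' d₁ a) (hd' : IsSliced b' d₂ b) (hf : IsSliced a f b)
    (hg : IsSliced a' g b')
    (h₁ : WordEquiv S a' a' (d₁ ++ c₁) []) (h₂ : WordEquiv S b b (c₂ ++ d₂) []) :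
    WordEquiv S a' b (d₁ ++ f) (g ++ d₂) := by
  -- d₁ f = d₁ f c₂ d₂ = d₁ c₁ g d₂ = g d₂; one-sided inverses are enough.
  have e₁ := ((refl hd).comp (refl hf)).comp h₂
  have e₂ := ((refl hd).comp h).comp (refl hd')
  have e₃ := (h₁.comp (refl hg)).comp (refl hd')
  simp only [List.append_nil, List.nil_append, List.append_assoc] at e₁ e₂ e₃
  exact e₁.symm.trans (e₂.trans e₃)

/-! ### Local moves as equivalences -/

theorem exchange (e f : Event) (m : List Dir) :
    WordEquiv S (e.bot ++ m ++ f.bot) (e.top ++ m ++ f.top)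
      [⟨[], e, m ++ f.bot⟩, ⟨e.top ++ m, f, []⟩] [⟨e.bot ++ m, f, []⟩, ⟨[], e, m ++ f.top⟩] :=
  of_move (.inl (.exchange e f m)) (by simp [IsSliced, Layer.bot, Layer.top])
    (by simp [IsSliced, Layer.bot, Layer.top])

theorem zigzagRight (d : Dir) :
    WordEquiv S [d] [d] [⟨[d], .cup d.flip, []⟩, ⟨[], .cap d, [d]⟩] [] :=
  of_move (.inl (.zigzagRight d)) (by simp [IsSliced, Layer.bot, Layer.top, Event.bot, Event.top])
    (by simp [IsSliced])

theorem zigzagLeft (d : Dir) :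
    WordEquiv S [d] [d] [⟨[], .cup d, [d]⟩, ⟨[d], .cap d.flip, []⟩] [] :=
  of_move (.inl (.zigzagLeft d)) (by simp [IsSliced, Layer.bot, Layer.top, Event.bot, Event.top])
    (by simp [IsSliced])

theorem capSlide (k : Kind) (p q : Dir) :
    WordEquiv S [p, q, p.flip] [q]
      [⟨[], .cross k p q, [p.flip]⟩, ⟨[q], .cap p, []⟩]
      [⟨[p], .cross k.swap q p.flip, []⟩, ⟨[], .cap p, [q]⟩] :=
  of_move (.inl (.capSlide k p q)) (by simp [IsSliced, Layer.bot, Layer.top, Event.bot, Event.top])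
    (by simp [IsSliced, Layer.bot, Layer.top, Event.bot, Event.top])

/-- This form keeps double swaps out of the chains below. -/
theorem capSlide_swap (k : Kind) (p q : Dir) :
    WordEquiv S [p, q, p.flip] [q]
      [⟨[], .cross k.swap p q, [p.flip]⟩, ⟨[q], .cap p, []⟩]
      [⟨[p], .cross k q p.flip, []⟩, ⟨[], .cap p, [q]⟩] := by
  simpa using capSlide (S := S) k.swap p q

theorem cupSlide (k : Kind) (p q : Dir) :
    WordEquiv S [q] [p, q, p.flip]
      [⟨[q], .cup p, []⟩, ⟨[], .cross k q p, [p.flip]⟩]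
      [⟨[], .cup p, [q]⟩, ⟨[p], .cross k.swap p.flip q, []⟩] :=
  of_move (.inl (.cupSlide k p q)) (by simp [IsSliced, Layer.bot, Layer.top, Event.bot, Event.top])
    (by simp [IsSliced, Layer.bot, Layer.top, Event.bot, Event.top])

theorem cupSlide_swap (k : Kind) (p q : Dir) :
    WordEquiv S [q] [p, q, p.flip]
      [⟨[q], .cup p, []⟩, ⟨[], .cross k.swap q p, [p.flip]⟩]
      [⟨[], .cup p, [q]⟩, ⟨[p], .cross k p.flip q, []⟩] := by
  simpa using cupSlide (S := S) k.swap p q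

theorem oneRight {k : Kind} (hk : k.IsClassical) (d : Dir) :
    WordEquiv S [d] [d]
      [⟨[d], .cup d, []⟩, ⟨[], .cross k d d, [d.flip]⟩, ⟨[d], .cap d, []⟩] [] :=
  of_move (.inr (.inl (.oneRight k hk d)))
    (by simp [IsSliced, Layer.bot, Layer.top, Event.bot, Event.top]) (by simp [IsSliced])

theorem two {k : Kind} (hk : k.IsClassical) (p q : Dir) :
    WordEquiv S [p, q] [p, q] [⟨[], .cross k p q, []⟩, ⟨[], .cross k.swap q p, []⟩] [] :=
  of_move (.inr (.inl (.two k hk p q)))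
    (by simp [IsSliced, Layer.bot, Layer.top, Event.bot, Event.top]) (by simp [IsSliced])

theorem two_swap {k : Kind} (hk : k.IsClassical) (p q : Dir) :
    WordEquiv S [p, q] [p, q] [⟨[], .cross k.swap p q, []⟩, ⟨[], .cross k q p, []⟩] [] := by
  simpa using two (S := S) hk.swap p q

/-! ### Bending of strands -/

/-- An event exchanges its height with all layers of a word on its right. -/
theorem interchange (e : Event) (h : IsSliced x w y) :
    WordEquiv S (e.bot ++ x) (e.top ++ y)
      (⟨[], e, x⟩ :: w.map (Layer.widen e.top [])) (w.map (Layer.widen e.bot []) ++ [⟨[], e, y⟩]) := by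
  induction w generalizing x with
  | nil =>
    obtain rfl : x = y := h
    exact refl (by simp [IsSliced, Layer.bot, Layer.top])
  | cons s w ih =>
    obtain ⟨rfl, h⟩ := h
    obtain ⟨l, f, r⟩ := s
    have h₁ := ((exchange (S := S) e f l).widen [] r).comp
      (refl (w := w.map (Layer.widen e.top [])) (b := e.top ++ y)
        (by simpa [Layer.top] using h.widen e.top []))
    have h₂ := (refl (S := S) (a := e.bot ++ Layer.bot ⟨l, f, r⟩)
      (w := [Layer.widen e.bot [] ⟨l, f, r⟩])
      (b := e.bot ++ Layer.top ⟨l, f, r⟩)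
      (by simp [IsSliced, Layer.bot, Layer.top, Layer.widen])).comp (ih h)
    simp only [List.map_cons, List.map_nil, List.append_assoc, List.nil_append, List.append_nil,
      List.cons_append, Layer.widen, Layer.bot, Layer.top] at h₁ h₂ ⊢
    exact h₁.trans h₂

/-- Bending an upper left endpoint down by a maximum loses no information. -/
theorem of_cap {A B : List Layer} (r : Dir)
    (hA : IsSliced x A (r.flip :: y)) (hB : IsSliced x B (r.flip :: y))
    (h : WordEquiv S (r :: x) y (A.map (Layer.widen [r] []) ++ [⟨[], .cap r, y⟩])
      (B.map (Layer.widen [r] []) ++ [⟨[], .cap r, y⟩])) :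
    WordEquiv S x (r.flip :: y) A B := by
  -- A zigzag is inserted at the upper left end of `C`, and its minimum is pulled down past all of
  -- `C`. This recovers `C` from its bent form.
  have key : ∀ C, IsSliced x C (r.flip :: y) →
      WordEquiv S x (r.flip :: y) C ([⟨[], .cup r.flip, x⟩] ++
        (C.map (Layer.widen [r] []) ++ [(⟨[], .cap r, y⟩ : Layer)]).map (Layer.widen [r.flip] [])) := by
    intro C hC
    have h₁ := (interchange (S := S) (.cup r.flip) hC).comp
      (refl (w := [⟨[r.flip], .cap r, y⟩]) (a := (Event.cup r.flip).top ++ r.flip :: y)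
        (b := r.flip :: y)
        (by simp [IsSliced, Layer.bot, Layer.top, Event.bot, Event.top]))
    have h₂ := (refl hC).comp ((zigzagLeft (S := S) r.flip).widen [] y)
    simp only [List.map_cons, List.map_nil, List.append_assoc, List.nil_append, List.append_nil,
      List.cons_append, Layer.widen, Event.bot, Event.top, Dir.flip_flip, List.map_append,
      map_widen_widen, List.map_id, Layer.widen_nil] at h₁ h₂ ⊢
    exact h₂.symm.trans h₁.symm
  have h' := (refl (S := S) (a := x) (w := [⟨[], .cup r.flip, x⟩]) (b := r.flip :: r :: x)
    (by simp [IsSliced, Layer.bot, Layer.top, Event.bot, Event.top])).comp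
      (by simpa only [List.append_nil, List.cons_append, List.nil_append] using h.widen [r.flip] [])
  exact (key A hA).trans (h'.trans (key B hB).symm)

/-! ### Consequences of the classical moves -/

/-- A strand passes across a local minimum. -/
theorem cupPass {k : Kind} (hk : k.IsClassical) (p r : Dir) :
    WordEquiv S [r] [r, p, p.flip]
      [⟨[], .cup p, [r]⟩, ⟨[p], .cross k p.flip r, []⟩, ⟨[], .cross k p r, [p.flip]⟩]
      [⟨[r], .cup p, []⟩] :=
  calc
    WordEquiv S [r] [r, p, p.flip]
      [⟨[], .cup p, [r]⟩, ⟨[p], .cross k p.flip r, []⟩, ⟨[], .cross k p r, [p.flip]⟩]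
      [⟨[r], .cup p, []⟩, ⟨[], .cross k.swap r p, [p.flip]⟩, ⟨[], .cross k p r, [p.flip]⟩] :=
        (cupSlide_swap k p r).symm.replace 0 [] []
    WordEquiv S [r] [r, p, p.flip] _ [⟨[r], .cup p, []⟩] := (two_swap hk r p).replace 1 [] [p.flip]

/-- A crossing of the two legs of a local minimum can be removed. -/
theorem kinkCup {k : Kind} (hk : k.IsClassical) (d : Dir) :
    WordEquiv S [] [d.flip, d]
      [⟨[], .cup d, []⟩, ⟨[], .cross k d d.flip, []⟩] [⟨[], .cup d.flip, []⟩] := by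
  refine of_cap d (by simp [IsSliced, Layer.bot, Layer.top, Event.bot, Event.top])
    (by simp [IsSliced, Layer.bot, Layer.top, Event.bot, Event.top]) ?_
  -- Once the right end of the kink is reached through the maximum, the crossing slides through it
  -- and forms a Reidemeister I loop on one strand.
  exact calc
    WordEquiv S [d] [d]
      [⟨[d], .cup d, []⟩, ⟨[d], .cross k d d.flip, []⟩, ⟨[], .cap d, [d]⟩]
      [⟨[d], .cup d, []⟩, ⟨[], .cross k.swap d d, [d.flip]⟩, ⟨[d], .cap d, []⟩] :=
        (capSlide_swap k d d).symm.replace 1 [] []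
    WordEquiv S [d] [d] _ [] := (oneRight hk.swap d).replace 0 [] []
    WordEquiv S [d] [d] _ [⟨[d], .cup d.flip, []⟩, ⟨[], .cap d, [d]⟩] :=
      (zigzagRight d).symm.replace 0 [] []

/-- A crossing of the two legs of a local maximum can be removed. -/
theorem kinkCap {k : Kind} (hk : k.IsClassical) (d : Dir) :
    WordEquiv S [d, d.flip] []
      [⟨[], .cross k d d.flip, []⟩, ⟨[], .cap d.flip, []⟩] [⟨[], .cap d, []⟩] :=
  -- The zigzag provides a minimum through which the crossing can slide, so that the kink becomes a
  -- Reidemeister I loop on the right strand.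
  calc
    WordEquiv S [d, d.flip] []
      [⟨[], .cross k d d.flip, []⟩, ⟨[], .cap d.flip, []⟩]
      [⟨[d], .cup d.flip, [d.flip]⟩, ⟨[], .cap d, [d, d.flip]⟩, ⟨[], .cross k d d.flip, []⟩,
        ⟨[], .cap d.flip, []⟩] := (zigzagRight d).symm.replace 0 [] [d.flip]
    WordEquiv S [d, d.flip] [] _
      [⟨[d], .cup d.flip, [d.flip]⟩, ⟨[d, d.flip], .cross k d d.flip, []⟩,
        ⟨[], .cap d, [d.flip, d]⟩, ⟨[], .cap d.flip, []⟩] :=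
      (exchange (.cap d) (.cross k d d.flip) []).replace 1 [] []
    WordEquiv S [d, d.flip] [] _
      [⟨[d], .cup d.flip, [d.flip]⟩, ⟨[d, d.flip], .cross k d d.flip, []⟩,
        ⟨[d, d.flip], .cap d.flip, []⟩, ⟨[], .cap d, []⟩] :=
      (exchange (.cap d) (.cap d.flip) []).replace 2 [] []
    WordEquiv S [d, d.flip] [] _
      [⟨[d, d.flip], .cup d.flip, []⟩, ⟨[d], .cross k.swap d.flip d.flip, [d]⟩,
        ⟨[d, d.flip], .cap d.flip, []⟩, ⟨[], .cap d, []⟩] :=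
      (cupSlide_swap k d.flip d.flip).symm.replace 0 [d] []
    WordEquiv S [d, d.flip] [] _ [⟨[], .cap d, []⟩] := (oneRight hk.swap d.flip).replace 0 [d] []

/-- The strand `r` crosses two strands and returns, on one level throughout. With `passTwo_swap`
this gives the inverses that `conj` needs for Ω4. -/
theorem passTwo {k : Kind} (hk : k.IsClassical) (p q r : Dir) :
    WordEquiv S [p, q, r] [p, q, r]
      [⟨[p], .cross k q r, []⟩, ⟨[], .cross k p r, [q]⟩,
        ⟨[], .cross k.swap r p, [q]⟩, ⟨[p], .cross k.swap r q, []⟩] [] :=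
  calc
    WordEquiv S [p, q, r] [p, q, r]
      [⟨[p], .cross k q r, []⟩, ⟨[], .cross k p r, [q]⟩,
        ⟨[], .cross k.swap r p, [q]⟩, ⟨[p], .cross k.swap r q, []⟩]
      [⟨[p], .cross k q r, []⟩, ⟨[p], .cross k.swap r q, []⟩] := (two hk p r).replace 1 [] [q]
    WordEquiv S [p, q, r] [p, q, r] _ [] := (two hk q r).replace 0 [p] []

theorem passTwo_swap {k : Kind} (hk : k.IsClassical) (p q r : Dir) :
    WordEquiv S [r, p, q] [r, p, q]
      [⟨[], .cross k.swap r p, [q]⟩, ⟨[p], .cross k.swap r q, []⟩,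
        ⟨[p], .cross k q r, []⟩, ⟨[], .cross k p r, [q]⟩] [] :=
  calc
    WordEquiv S [r, p, q] [r, p, q]
      [⟨[], .cross k.swap r p, [q]⟩, ⟨[p], .cross k.swap r q, []⟩,
        ⟨[p], .cross k q r, []⟩, ⟨[], .cross k p r, [q]⟩]
      [⟨[], .cross k.swap r p, [q]⟩, ⟨[], .cross k p r, [q]⟩] :=
        (two_swap hk r q).replace 1 [p] []
    WordEquiv S [r, p, q] [r, p, q] _ [] := (two_swap hk r p).replace 0 [] [q]

end WordEquiv

/-! ### Moves past a singular crossing -/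

open WordEquiv

variable {S : List Layer → List Layer → Prop}

/-- A strand `r` from bottom right to top left passes across the singular crossing of the strands
`p` and `q`. -/
abbrev NWPass (S : List Layer → List Layer → Prop) (k : Kind) (p q r : Dir) : Prop :=
  WordEquiv S [p, q, r] [r, q, p] (triangleLow .singular k k p q r)
    (triangleHigh .singular k k p q r)

/-- A strand `r` from bottom left to top right passes across the singular crossing of the strands
`p` and `q`. -/
abbrev NEPass (S : List Layer → List Layer → Prop) (k : Kind) (r p q : Dir) : Prop :=
  WordEquiv S [r, p, q] [q, p, r] (triangleLow k k .singular r p q)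
    (triangleHigh k k .singular r p q)

/-- A classical crossing of the strands `p` and `q` passes across their singular crossing. -/
abbrev CrossingPass (S : List Layer → List Layer → Prop) (k : Kind) (p q : Dir) : Prop :=
  WordEquiv S [p, q] [p, q]
    [⟨[], .cross .singular p q, []⟩, ⟨[], .cross k q p, []⟩]
    [⟨[], .cross k p q, []⟩, ⟨[], .cross .singular q p, []⟩]

/-- Both crossings with `r` are replaced by their inverses. `k` becomes `k.swap` because `r` now
runs along the other diagonal; its level is unchanged. -/
theorem NWPass.toNEPass {k : Kind} (hk : k.IsClassical) {p q r : Dir} (h : NWPass S k p q r) :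
    NEPass S k.swap r p q := by
  refine WordEquiv.conj (a := [p, q, r]) (b := [q, p, r]) (a' := [r, p, q]) (b' := [r, q, p])
    (f := [⟨[], .cross .singular p q, [r]⟩]) (g := [⟨[r], .cross .singular p q, []⟩])
    (c₁ := [⟨[p], .cross k q r, []⟩, ⟨[], .cross k p r, [q]⟩])
    (c₂ := [⟨[q], .cross k p r, []⟩, ⟨[], .cross k q r, [p]⟩])
    (d₁ := [⟨[], .cross k.swap r p, [q]⟩, ⟨[p], .cross k.swap r q, []⟩])
    (d₂ := [⟨[], .cross k.swap r q, [p]⟩, ⟨[q], .cross k.swap r p, []⟩])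
    h ?_ ?_ ?_ ?_ (passTwo_swap hk p q r) (passTwo hk q p r) <;>
  simp [IsSliced, Layer.bot, Layer.top, Event.bot, Event.top]

theorem NEPass.toNWPass {k : Kind} (hk : k.IsClassical) {p q r : Dir} (h : NEPass S k.swap r p q) :
    NWPass S k p q r := by
  refine (WordEquiv.conj (a' := [p, q, r]) (b' := [q, p, r]) (a := [r, p, q]) (b := [r, q, p])
    (g := [⟨[], .cross .singular p q, [r]⟩]) (f := [⟨[r], .cross .singular p q, []⟩])
    (d₁ := [⟨[p], .cross k q r, []⟩, ⟨[], .cross k p r, [q]⟩])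
    (d₂ := [⟨[q], .cross k p r, []⟩, ⟨[], .cross k q r, [p]⟩])
    (c₁ := [⟨[], .cross k.swap r p, [q]⟩, ⟨[p], .cross k.swap r q, []⟩])
    (c₂ := [⟨[], .cross k.swap r q, [p]⟩, ⟨[q], .cross k.swap r p, []⟩])
    h.symm ?_ ?_ ?_ ?_ (passTwo hk p q r) (passTwo_swap hk q p r)).symm <;>
  simp [IsSliced, Layer.bot, Layer.top, Event.bot, Event.top]

/-- By Reidemeister II the crossing `k.swap` is inverse to `k`, so `conj` applies. -/
theorem CrossingPass.inverse {k : Kind} (hk : k.IsClassical) {p q : Dir}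
    (h : CrossingPass S k p q) : CrossingPass S k.swap q p := by
  refine (WordEquiv.conj (a := [p, q]) (b := [q, p]) (a' := [q, p]) (b' := [p, q])
    (f := [⟨[], .cross .singular p q, []⟩]) (g := [⟨[], .cross .singular q p, []⟩])
    (c₁ := [⟨[], .cross k p q, []⟩]) (c₂ := [⟨[], .cross k q p, []⟩])
    (d₁ := [⟨[], .cross k.swap q p, []⟩]) (d₂ := [⟨[], .cross k.swap p q, []⟩])
    h ?_ ?_ ?_ ?_ (two_swap hk q p) (two hk q p)).symm <;>
  simp [IsSliced, Layer.bot, Layer.top, Event.bot, Event.top]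

/-- Rotation of the third strand. -/
theorem NEPass.flip {k : Kind} {p q r : Dir} (h : NEPass S k r p q) :
    NWPass S k.swap p q r.flip := by
  refine of_cap r
    (by simp [IsSliced, triangleLow, Layer.bot, Layer.top, Event.bot, Event.top])
    (by simp [IsSliced, triangleHigh, Layer.bot, Layer.top, Event.bot, Event.top]) ?_
  -- The bent strand rises on the left and comes down on the right. Its crossings slide to the left
  -- leg, where `h` applies, and then back to the right leg.
  exact calc
    WordEquiv S [r, p, q, r.flip] [q, p]
      [⟨[r], .cross .singular p q, [r.flip]⟩, ⟨[r, q], .cross k.swap p r.flip, []⟩,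
        ⟨[r], .cross k.swap q r.flip, [p]⟩, ⟨[], .cap r, [q, p]⟩]
      [⟨[r], .cross .singular p q, [r.flip]⟩, ⟨[r, q], .cross k.swap p r.flip, []⟩,
        ⟨[], .cross k r q, [r.flip, p]⟩, ⟨[q], .cap r, [p]⟩] :=
        (capSlide k r q).symm.replace 2 [] [p]
    WordEquiv S [r, p, q, r.flip] [q, p] _
      [⟨[r], .cross .singular p q, [r.flip]⟩, ⟨[], .cross k r q, [p, r.flip]⟩,
        ⟨[q, r], .cross k.swap p r.flip, []⟩, ⟨[q], .cap r, [p]⟩] :=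
      (exchange (.cross k r q) (.cross k.swap p r.flip) []).symm.replace 1 [] []
    WordEquiv S [r, p, q, r.flip] [q, p] _
      [⟨[r], .cross .singular p q, [r.flip]⟩, ⟨[], .cross k r q, [p, r.flip]⟩,
        ⟨[q], .cross k r p, [r.flip]⟩, ⟨[q, p], .cap r, []⟩] :=
      (capSlide k r p).symm.replace 2 [q] []
    WordEquiv S [r, p, q, r.flip] [q, p] _
      [⟨[], .cross k r p, [q, r.flip]⟩, ⟨[p], .cross k r q, [r.flip]⟩,
        ⟨[], .cross .singular p q, [r, r.flip]⟩, ⟨[q, p], .cap r, []⟩] :=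
      h.symm.replace 0 [] [r.flip]
    WordEquiv S [r, p, q, r.flip] [q, p] _
      [⟨[], .cross k r p, [q, r.flip]⟩, ⟨[p], .cross k r q, [r.flip]⟩,
        ⟨[p, q], .cap r, []⟩, ⟨[], .cross .singular p q, []⟩] :=
      (exchange (.cross .singular p q) (.cap r) []).replace 2 [] []
    WordEquiv S [r, p, q, r.flip] [q, p] _
      [⟨[], .cross k r p, [q, r.flip]⟩, ⟨[p, r], .cross k.swap q r.flip, []⟩,
        ⟨[p], .cap r, [q]⟩, ⟨[], .cross .singular p q, []⟩] :=
      (capSlide k r q).replace 1 [p] []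
    WordEquiv S [r, p, q, r.flip] [q, p] _
      [⟨[r, p], .cross k.swap q r.flip, []⟩, ⟨[], .cross k r p, [r.flip, q]⟩,
        ⟨[p], .cap r, [q]⟩, ⟨[], .cross .singular p q, []⟩] :=
      (exchange (.cross k r p) (.cross k.swap q r.flip) []).replace 0 [] []
    WordEquiv S [r, p, q, r.flip] [q, p] _
      [⟨[r, p], .cross k.swap q r.flip, []⟩, ⟨[r], .cross k.swap p r.flip, [q]⟩,
        ⟨[], .cap r, [p, q]⟩, ⟨[], .cross .singular p q, []⟩] :=
      (capSlide k r p).replace 1 [] [q]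
    WordEquiv S [r, p, q, r.flip] [q, p] _
      [⟨[r, p], .cross k.swap q r.flip, []⟩, ⟨[r], .cross k.swap p r.flip, [q]⟩,
        ⟨[r, r.flip], .cross .singular p q, []⟩, ⟨[], .cap r, [q, p]⟩] :=
      (exchange (.cap r) (.cross .singular p q) []).replace 2 [] []

/-- The third strand starts and ends between the strands of the singular crossing. -/
theorem NEPass.middle {k : Kind} (hk : k.IsClassical) {p q r : Dir} (h : NEPass S k r p q) :
    WordEquiv S [p, r, q] [q, r, p]
      [⟨[], .cross k.swap p r, [q]⟩, ⟨[r], .cross .singular p q, []⟩, ⟨[], .cross k r q, [p]⟩]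
      [⟨[p], .cross k r q, []⟩, ⟨[], .cross .singular p q, [r]⟩, ⟨[q], .cross k.swap p r, []⟩] :=
  calc
    WordEquiv S [p, r, q] [q, r, p]
      [⟨[], .cross k.swap p r, [q]⟩, ⟨[r], .cross .singular p q, []⟩, ⟨[], .cross k r q, [p]⟩]
      [⟨[], .cross k.swap p r, [q]⟩, ⟨[r], .cross .singular p q, []⟩, ⟨[], .cross k r q, [p]⟩,
        ⟨[q], .cross k r p, []⟩, ⟨[q], .cross k.swap p r, []⟩] :=
        (two hk r p).symm.replace 3 [q] []
    WordEquiv S [p, r, q] [q, r, p] _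
      [⟨[], .cross k.swap p r, [q]⟩, ⟨[], .cross k r p, [q]⟩, ⟨[p], .cross k r q, []⟩,
        ⟨[], .cross .singular p q, [r]⟩, ⟨[q], .cross k.swap p r, []⟩] :=
      h.symm.replace 1 [] []
    WordEquiv S [p, r, q] [q, r, p] _
      [⟨[p], .cross k r q, []⟩, ⟨[], .cross .singular p q, [r]⟩, ⟨[q], .cross k.swap p r, []⟩] :=
      (two_swap hk p r).replace 0 [] [q]

/-- Rotation of the singular crossing. -/
theorem NEPass.rotate {k : Kind} (hk : k.IsClassical) {p q r : Dir} (h : NEPass S k r p q) :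
    NEPass S k r q p.flip := by
  refine of_cap p
    (by simp [IsSliced, triangleLow, Layer.bot, Layer.top, Event.bot, Event.top])
    (by simp [IsSliced, triangleHigh, Layer.bot, Layer.top, Event.bot, Event.top]) ?_
  -- Sliding through the maximum of `p` turns the singular crossing into one of `p` and `q`. The
  -- crossing of `r` with the right leg slides along, so `r` enters between `p` and `q`, as in
  -- `NEPass.middle`.
  exact calc
    WordEquiv S [p, r, q, p.flip] [q, r]
      [⟨[p], .cross k r q, [p.flip]⟩, ⟨[p, q], .cross k r p.flip, []⟩,
        ⟨[p], .cross .singular q p.flip, [r]⟩, ⟨[], .cap p, [q, r]⟩]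
      [⟨[p], .cross k r q, [p.flip]⟩, ⟨[p, q], .cross k r p.flip, []⟩,
        ⟨[], .cross .singular p q, [p.flip, r]⟩, ⟨[q], .cap p, [r]⟩] :=
        (capSlide .singular p q).symm.replace 2 [] [r]
    WordEquiv S [p, r, q, p.flip] [q, r] _
      [⟨[p], .cross k r q, [p.flip]⟩, ⟨[], .cross .singular p q, [r, p.flip]⟩,
        ⟨[q, p], .cross k r p.flip, []⟩, ⟨[q], .cap p, [r]⟩] :=
      (exchange (.cross .singular p q) (.cross k r p.flip) []).symm.replace 1 [] []
    WordEquiv S [p, r, q, p.flip] [q, r] _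
      [⟨[p], .cross k r q, [p.flip]⟩, ⟨[], .cross .singular p q, [r, p.flip]⟩,
        ⟨[q], .cross k.swap p r, [p.flip]⟩, ⟨[q, r], .cap p, []⟩] :=
      (capSlide_swap k p r).symm.replace 2 [q] []
    WordEquiv S [p, r, q, p.flip] [q, r] _
      [⟨[], .cross k.swap p r, [q, p.flip]⟩, ⟨[r], .cross .singular p q, [p.flip]⟩,
        ⟨[], .cross k r q, [p, p.flip]⟩, ⟨[q, r], .cap p, []⟩] :=
      (h.middle hk).symm.replace 0 [] [p.flip]
    WordEquiv S [p, r, q, p.flip] [q, r] _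
      [⟨[], .cross k.swap p r, [q, p.flip]⟩, ⟨[r], .cross .singular p q, [p.flip]⟩,
        ⟨[r, q], .cap p, []⟩, ⟨[], .cross k r q, []⟩] :=
      (exchange (.cross k r q) (.cap p) []).replace 2 [] []
    WordEquiv S [p, r, q, p.flip] [q, r] _
      [⟨[], .cross k.swap p r, [q, p.flip]⟩, ⟨[r, p], .cross .singular q p.flip, []⟩,
        ⟨[r], .cap p, [q]⟩, ⟨[], .cross k r q, []⟩] :=
      (capSlide .singular p q).replace 1 [r] []
    WordEquiv S [p, r, q, p.flip] [q, r] _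
      [⟨[p, r], .cross .singular q p.flip, []⟩, ⟨[], .cross k.swap p r, [p.flip, q]⟩,
        ⟨[r], .cap p, [q]⟩, ⟨[], .cross k r q, []⟩] :=
      (exchange (.cross k.swap p r) (.cross .singular q p.flip) []).replace 0 [] []
    WordEquiv S [p, r, q, p.flip] [q, r] _
      [⟨[p, r], .cross .singular q p.flip, []⟩, ⟨[p], .cross k r p.flip, [q]⟩,
        ⟨[], .cap p, [r, q]⟩, ⟨[], .cross k r q, []⟩] :=
      (capSlide_swap k p r).replace 1 [] [q]
    WordEquiv S [p, r, q, p.flip] [q, r] _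
      [⟨[p, r], .cross .singular q p.flip, []⟩, ⟨[p], .cross k r p.flip, [q]⟩,
        ⟨[p, p.flip], .cross k r q, []⟩, ⟨[], .cap p, [q, r]⟩] :=
      (exchange (.cap p) (.cross k r q) []).replace 2 [] []

/-- Rotation of the strand `p` of the singular crossing in the move of a classical crossing. -/
theorem CrossingPass.rotate {k : Kind} (hk : k.IsClassical) {p q : Dir}
    (h : CrossingPass S k.swap q p) (hne : NEPass S k p.flip p q) (hnw : NWPass S k q p p.flip) :
    CrossingPass S k q p.flip :=
  calc
    -- The zigzag provides a minimum through which the singular crossing slides; it becomes a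
    -- crossing of `p` and `q`.
    WordEquiv S [q, p.flip] [q, p.flip]
      [⟨[], .cross .singular q p.flip, []⟩, ⟨[], .cross k p.flip q, []⟩]
      [⟨[q], .cup p.flip, [p.flip]⟩, ⟨[q, p.flip], .cap p, []⟩,
        ⟨[], .cross .singular q p.flip, []⟩, ⟨[], .cross k p.flip q, []⟩] :=
        (zigzagLeft p.flip).symm.replace 0 [q] []
    WordEquiv S [q, p.flip] [q, p.flip] _
      [⟨[q], .cup p.flip, [p.flip]⟩, ⟨[], .cross .singular q p.flip, [p, p.flip]⟩,
        ⟨[p.flip, q], .cap p, []⟩, ⟨[], .cross k p.flip q, []⟩] :=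
      (exchange (.cross .singular q p.flip) (.cap p) []).symm.replace 1 [] []
    WordEquiv S [q, p.flip] [q, p.flip] _
      [⟨[], .cup p.flip, [q, p.flip]⟩, ⟨[p.flip], .cross .singular p q, [p.flip]⟩,
        ⟨[p.flip, q], .cap p, []⟩, ⟨[], .cross k p.flip q, []⟩] :=
      (cupSlide .singular p.flip q).replace 0 [] [p.flip]
    WordEquiv S [q, p.flip] [q, p.flip] _
      [⟨[], .cup p.flip, [q, p.flip]⟩, ⟨[p.flip], .cross .singular p q, [p.flip]⟩,
        ⟨[], .cross k p.flip q, [p, p.flip]⟩, ⟨[q, p.flip], .cap p, []⟩] :=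
      (exchange (.cross k p.flip q) (.cap p) []).symm.replace 2 [] []
    -- The left arc of the zigzag serves as the third strand of `hne`. Its missing crossing with `p`
    -- comes from a Reidemeister II pair, whose other half stays above.
    WordEquiv S [q, p.flip] [q, p.flip] _
      [⟨[], .cup p.flip, [q, p.flip]⟩, ⟨[p.flip], .cross .singular p q, [p.flip]⟩,
        ⟨[], .cross k p.flip q, [p, p.flip]⟩, ⟨[q], .cross k p.flip p, [p.flip]⟩,
        ⟨[q], .cross k.swap p p.flip, [p.flip]⟩, ⟨[q, p.flip], .cap p, []⟩] :=
      (two hk p.flip p).symm.replace 3 [q] [p.flip]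
    WordEquiv S [q, p.flip] [q, p.flip] _
      [⟨[], .cup p.flip, [q, p.flip]⟩, ⟨[], .cross k p.flip p, [q, p.flip]⟩,
        ⟨[p], .cross k p.flip q, [p.flip]⟩, ⟨[], .cross .singular p q, [p.flip, p.flip]⟩,
        ⟨[q], .cross k.swap p p.flip, [p.flip]⟩, ⟨[q, p.flip], .cap p, []⟩] :=
      hne.symm.replace 1 [] [p.flip]
    -- The crossing with `p` is now a kink at the minimum. Without it, the remaining crossing with
    -- `q` slides to the position required by `h`.
    WordEquiv S [q, p.flip] [q, p.flip] _
      [⟨[], .cup p, [q, p.flip]⟩,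
        ⟨[p], .cross k p.flip q, [p.flip]⟩, ⟨[], .cross .singular p q, [p.flip, p.flip]⟩,
        ⟨[q], .cross k.swap p p.flip, [p.flip]⟩, ⟨[q, p.flip], .cap p, []⟩] :=
      (kinkCup hk p.flip).replace 0 [] [q, p.flip]
    WordEquiv S [q, p.flip] [q, p.flip] _
      [⟨[q], .cup p, [p.flip]⟩,
        ⟨[], .cross k.swap q p, [p.flip, p.flip]⟩, ⟨[], .cross .singular p q, [p.flip, p.flip]⟩,
        ⟨[q], .cross k.swap p p.flip, [p.flip]⟩, ⟨[q, p.flip], .cap p, []⟩] :=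
      (cupSlide_swap k p q).symm.replace 0 [] [p.flip]
    WordEquiv S [q, p.flip] [q, p.flip] _
      [⟨[q], .cup p, [p.flip]⟩,
        ⟨[], .cross .singular q p, [p.flip, p.flip]⟩, ⟨[], .cross k.swap p q, [p.flip, p.flip]⟩,
        ⟨[q], .cross k.swap p p.flip, [p.flip]⟩, ⟨[q, p.flip], .cap p, []⟩] :=
      h.symm.replace 1 [] [p.flip, p.flip]
    -- On the other side, the right arc is treated in the same manner: the two classical crossings
    -- above the singular one slide through the maximum.
    WordEquiv S [q, p.flip] [q, p.flip] _
      [⟨[q], .cup p, [p.flip]⟩,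
        ⟨[], .cross .singular q p, [p.flip, p.flip]⟩, ⟨[], .cross k.swap p q, [p.flip, p.flip]⟩,
        ⟨[q, p], .cross k p.flip p.flip, []⟩, ⟨[q], .cap p, [p.flip]⟩] :=
      (capSlide_swap k p p.flip).replace 3 [q] []
    WordEquiv S [q, p.flip] [q, p.flip] _
      [⟨[q], .cup p, [p.flip]⟩,
        ⟨[], .cross .singular q p, [p.flip, p.flip]⟩, ⟨[p, q], .cross k p.flip p.flip, []⟩,
        ⟨[], .cross k.swap p q, [p.flip, p.flip]⟩, ⟨[q], .cap p, [p.flip]⟩] :=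
      (exchange (.cross k.swap p q) (.cross k p.flip p.flip) []).replace 2 [] []
    WordEquiv S [q, p.flip] [q, p.flip] _
      [⟨[q], .cup p, [p.flip]⟩,
        ⟨[], .cross .singular q p, [p.flip, p.flip]⟩, ⟨[p, q], .cross k p.flip p.flip, []⟩,
        ⟨[p], .cross k q p.flip, [p.flip]⟩, ⟨[], .cap p, [q, p.flip]⟩] :=
      (capSlide_swap k p q).replace 3 [] [p.flip]
    -- A kink at the maximum supplies the second crossing of the third strand in `hnw`.
    WordEquiv S [q, p.flip] [q, p.flip] _
      [⟨[q], .cup p, [p.flip]⟩,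
        ⟨[], .cross .singular q p, [p.flip, p.flip]⟩, ⟨[p, q], .cross k p.flip p.flip, []⟩,
        ⟨[p], .cross k q p.flip, [p.flip]⟩, ⟨[], .cross k p p.flip, [q, p.flip]⟩,
        ⟨[], .cap p.flip, [q, p.flip]⟩] :=
      (kinkCap hk p).symm.replace 4 [] [q, p.flip]
    WordEquiv S [q, p.flip] [q, p.flip] _
      [⟨[q], .cup p, [p.flip]⟩,
        ⟨[q, p], .cross k p.flip p.flip, []⟩, ⟨[], .cross .singular q p, [p.flip, p.flip]⟩,
        ⟨[p], .cross k q p.flip, [p.flip]⟩, ⟨[], .cross k p p.flip, [q, p.flip]⟩,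
        ⟨[], .cap p.flip, [q, p.flip]⟩] :=
      (exchange (.cross .singular q p) (.cross k p.flip p.flip) []).replace 1 [] []
    WordEquiv S [q, p.flip] [q, p.flip] _
      [⟨[q], .cup p, [p.flip]⟩,
        ⟨[q, p], .cross k p.flip p.flip, []⟩, ⟨[q], .cross k p p.flip, [p.flip]⟩,
        ⟨[], .cross k q p.flip, [p, p.flip]⟩, ⟨[p.flip], .cross .singular q p, [p.flip]⟩,
        ⟨[], .cap p.flip, [q, p.flip]⟩] :=
      hnw.replace 2 [] [p.flip]
    WordEquiv S [q, p.flip] [q, p.flip] _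
      [⟨[q, p.flip], .cup p, []⟩,
        ⟨[], .cross k q p.flip, [p, p.flip]⟩, ⟨[p.flip], .cross .singular q p, [p.flip]⟩,
        ⟨[], .cap p.flip, [q, p.flip]⟩] :=
      (cupPass hk p p.flip).replace 0 [q] []
    WordEquiv S [q, p.flip] [q, p.flip] _
      [⟨[q, p.flip], .cup p, []⟩,
        ⟨[], .cross k q p.flip, [p, p.flip]⟩, ⟨[], .cross .singular p.flip q, [p, p.flip]⟩,
        ⟨[q], .cap p.flip, [p.flip]⟩] :=
      (capSlide .singular p.flip q).symm.replace 2 [] [p.flip]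
    WordEquiv S [q, p.flip] [q, p.flip] _
      [⟨[], .cross k q p.flip, []⟩,
        ⟨[p.flip, q], .cup p, []⟩, ⟨[], .cross .singular p.flip q, [p, p.flip]⟩,
        ⟨[q], .cap p.flip, [p.flip]⟩] :=
      (exchange (.cross k q p.flip) (.cup p) []).symm.replace 0 [] []
    WordEquiv S [q, p.flip] [q, p.flip] _
      [⟨[], .cross k q p.flip, []⟩,
        ⟨[], .cross .singular p.flip q, []⟩, ⟨[q, p.flip], .cup p, []⟩,
        ⟨[q], .cap p.flip, [p.flip]⟩] :=
      (exchange (.cross .singular p.flip q) (.cup p) []).symm.replace 1 [] []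
    WordEquiv S [q, p.flip] [q, p.flip] _
      [⟨[], .cross k q p.flip, []⟩, ⟨[], .cross .singular p.flip q, []⟩] :=
      (zigzagRight p.flip).replace 2 [q] []

/-! ### Generation by the three moves -/

theorem threeMove_NEPass {k : Kind} (hk : k.IsClassical) (r p q : Dir) :
    NEPass ThreeMove k r p q := by
  have h₀ : ∀ k : Kind, k.IsClassical → NWPass ThreeMove k .up .up .up := by
    intro k hk
    refine .of_move (.inr (.inr ?_))
      (by simp [IsSliced, triangleLow, Layer.bot, Layer.top, Event.bot, Event.top])
      (by simp [IsSliced, triangleHigh, Layer.bot, Layer.top, Event.bot, Event.top])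
    cases k with
    | ne => exact .sIII'
    | nw => exact .sIII
    | singular => exact absurd rfl hk
  have h₁ : ∀ k : Kind, k.IsClassical → NEPass ThreeMove k .up .up .up := fun k hk => by
    simpa using (h₀ k.swap hk.swap).toNEPass hk.swap
  have h₂ : NEPass ThreeMove k r .up .up := by
    cases r with
    | up => exact h₁ k hk
    | down => simpa [Dir.flip] using (h₁ k hk).flip.toNEPass hk.swap
  -- Quarter turns run through (up, up), (up, down), (down, down), (down, up).
  cases p <;> cases q
  · exact h₂
  · exact h₂.rotate hk
  · exact ((h₂.rotate hk).rotate hk).rotate hk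
  · exact (h₂.rotate hk).rotate hk

theorem threeMove_NWPass {k : Kind} (hk : k.IsClassical) (p q r : Dir) :
    NWPass ThreeMove k p q r :=
  (threeMove_NEPass hk.swap r p q).toNWPass hk

theorem threeMove_CrossingPass {k : Kind} (hk : k.IsClassical) (p q : Dir) :
    CrossingPass ThreeMove k p q := by
  have h₀ : CrossingPass ThreeMove .ne .up .up :=
    .of_move (.inr (.inr .sII))
      (by simp [IsSliced, Layer.bot, Layer.top, Event.bot, Event.top])
      (by simp [IsSliced, Layer.bot, Layer.top, Event.bot, Event.top])
  have h₁ : ∀ k : Kind, k.IsClassical → CrossingPass ThreeMove k .up .up := by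
    intro k hk
    cases k with
    | ne => exact h₀
    | nw => exact h₀.inverse hk.swap
    | singular => exact absurd rfl hk
  -- Rotation and inversion both swap the crossing type, so the two types are carried along
  -- together.
  have rot : ∀ p q, (∀ k : Kind, k.IsClassical → CrossingPass ThreeMove k q p) →
      ∀ k : Kind, k.IsClassical → CrossingPass ThreeMove k q p.flip := fun p q h k hk =>
    (h k.swap hk.swap).rotate hk (threeMove_NEPass hk _ _ _) (threeMove_NWPass hk _ _ _)
  have inv : ∀ p q, (∀ k : Kind, k.IsClassical → CrossingPass ThreeMove k p q) →
      ∀ k : Kind, k.IsClassical → CrossingPass ThreeMove k q p := fun p q h k hk => by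
    simpa using (h k.swap hk.swap).inverse hk.swap
  have h₂ := rot _ _ h₁
  have h₃ := inv _ _ h₂
  cases p <;> cases q
  · exact h₁ k hk
  · exact h₂ k hk
  · exact h₃ k hk
  · exact rot _ _ h₃ k hk

theorem SingularMove.wordEquiv {L R : List Layer} (h : SingularMove L R) :
    ∃ a b, WordEquiv ThreeMove a b L R := by
  cases h with
  | four k hk p q r => exact ⟨_, _, threeMove_NWPass hk p q r⟩
  | five k hk p q => exact ⟨_, _, threeMove_CrossingPass hk p q⟩

theorem ThreeMove.singularMove {L R : List Layer} (h : ThreeMove L R) : SingularMove L R := by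
  cases h with
  | sII => exact .five _ (by simp [Kind.IsClassical]) _ _
  | sIII => exact .four _ (by simp [Kind.IsClassical]) _ _ _
  | sIII' => exact .four _ (by simp [Kind.IsClassical]) _ _ _

theorem SingularMove.ne_nil {L R : List Layer} (h : SingularMove L R) : L ≠ [] := by
  cases h <;> simp [triangleLow]

/-- The endpoints in the local derivation must agree with the slicing lines of the given diagram;
they do because the left side of a singular move is not empty. -/
theorem SingularMove.equivalent {L R s t : List Layer} {a b l r : List Dir} {D D' : Diagram a b}
    (h : SingularMove L R) (hD : D.layers = s ++ L.map (Layer.widen l r) ++ t)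
    (hD' : D'.layers = s ++ R.map (Layer.widen l r) ++ t) : Equivalent ThreeMove D D' := by
  obtain ⟨x, y, e⟩ := h.wordEquiv
  obtain ⟨w, hw⟩ := D
  obtain ⟨v, hv⟩ := D'
  subst hD hD'
  obtain ⟨m, hm, ht⟩ := isSliced_append.1 hw
  obtain ⟨n, hs, hL⟩ := isSliced_append.1 hm
  have hx := e.choose.widen l r
  obtain ⟨rfl, rfl⟩ := hL.endpoints_unique hx (by simpa using h.ne_nil)
  exact (e.inContext l r hs ht).choose_spec.choose_spec

end SingularLink

/-- In the presence of planar isotopy and of the oriented classical Reidemeister moves, the three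
moves sII, sIII, sIII′ generate the same equivalence of oriented singular tangle diagrams (link
diagrams if `a = b = []`) as the complete set of oriented singular moves. -/
theorem mainTheorem4 (a b : List SingularLink.Dir) (D D' : SingularLink.Diagram a b) :
    SingularLink.Equivalent SingularLink.ThreeMove D D' ↔
      SingularLink.Equivalent SingularLink.SingularMove D D' := by
  open SingularLink in
  constructor
  · refine Relation.EqvGen.mono ?_ D D'
    rintro D D' ⟨L, R, s, t, l, r, hM, h₁, h₂⟩
    exact ⟨L, R, s, t, l, r, hM.imp_right (Or.imp_right ThreeMove.singularMove), h₁, h₂⟩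
  · intro h
    induction h with
    | refl D => exact .refl _
    | symm _ _ _ ih => exact ih.symm _ _
    | trans _ _ _ _ _ ih ih' => exact ih.trans _ _ _ ih'
    | rel D D' h =>
      obtain ⟨L, R, s, t, l, r, hM | hM | hM, h₁, h₂⟩ := h
      · exact .rel _ _ ⟨L, R, s, t, l, r, .inl hM, h₁, h₂⟩
      · exact .rel _ _ ⟨L, R, s, t, l, r, .inr (.inl hM), h₁, h₂⟩
      · exact hM.equivalent h₁ h₂
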